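/- A continued fraction (CF) is given by two sequences $(a_n)_{n\ge0}$, $(b_n)_{n\ge0}$ of rational numbers with $b_n\neq0$ for all $n$, and its $n$-th convergent is $$\frac{p_n}{q_n}=a_0+\cfrac{b_0}{a_1+\cfrac{b_1}{\ddots+\cfrac{b_{n-1}}{a_n}}},$$ where $p_n,q_n$ are the usual numerators and denominators: $p_0=a_0$, $q_0=1$, $p_1=a_1a_0+b_0$, $q_1=a_1$, and $p_{n+2}=a_{n+2}p_{n+1}+b_{n+1}p_n$, $q_{n+2}=a_{n+2}q_{n+1}+b_{n+1}q_n$. The CF converges to $z\in\mathbb R$ if $q_n\ne0$ for $n$ sufficiently large and $p_n/q_n\to z$. A pair $(A,B)$ of polynomials with rational coefficients represents $z$ if there exists a CF converging to $z$ such that $a_n=A(n)$ and $b_n=B(n)$ for all sufficiently large $n$. Let $u,v,k$ be nonnegative integers, and put $$A(n)=3n^2+(8u+4v-3)n+(2u-1)(2u+2v-1),\qquad B(n)=-n(n+2u)(n+2u+2v)(2n+2u-2k-1).$$ Then the pair $(A,B)$ represents $\pi^2$. Moreover, for every CF that converges to $\pi^2$ and satisfies $a_n=A(n)$ and $b_n=B(n)$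 for all sufficiently large $n$, there is a nonzero real constant $C$ (depending on $u,v,k$ and the CF) such that $$\pi^2-\frac{p_n}{q_n}\sim\frac{C}{2^n\,n^{u+2v+3/2+3k}}\qquad(n\to\infty).$$ -/

import Mathlib

open Filter Topology Asymptotics

/-- A continued fraction `a₀ + b₀ / (a₁ + b₁ / (a₂ + b₂ / (a₃ + ⋯)))` with rational coefficients,
given by the pair of sequences `(aₙ, bₙ)`, all the `bₙ` being nonzero. -/
structure RatCF where
  a : ℕ → ℚ
  b : ℕ → ℚ
  b_ne_zero : ∀ n, b n ≠ 0

namespace RatCF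

/-- The same continued fraction as a Mathlib generalized continued fraction: the head is `a₀`, and
the `n`-th pair (partial numerator, partial denominator) is `(bₙ, aₙ₊₁)`. -/
def toGenContFract (F : RatCF) : GenContFract ℚ where
  h := F.a 0
  s := Stream'.Seq.ofStream fun n => ⟨F.b n, F.a (n + 1)⟩

/-- The numerator `pₙ` of the `n`-th convergent `a₀ + b₀ / (a₁ + ⋯ + bₙ₋₁ / aₙ)`. -/
def p (F : RatCF) (n : ℕ) : ℚ := F.toGenContFract.nums n

/-- The denominator `qₙ` of the `n`-th convergent `a₀ + b₀ / (a₁ + ⋯ + bₙ₋₁ / aₙ)`. -/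
def q (F : RatCF) (n : ℕ) : ℚ := F.toGenContFract.dens n

theorem p_zero (F : RatCF) : F.p 0 = F.a 0 := rfl

theorem q_zero (F : RatCF) : F.q 0 = 1 := rfl

theorem p_one (F : RatCF) : F.p 1 = F.a 1 * F.a 0 + F.b 0 := by
  have h : F.toGenContFract.s.get? 0 = some ⟨F.b 0, F.a 1⟩ := rfl
  exact GenContFract.first_num_eq h

theorem q_one (F : RatCF) : F.q 1 = F.a 1 := by
  have h : F.toGenContFract.s.get? 0 = some ⟨F.b 0, F.a 1⟩ := rfl
  exact GenContFract.first_den_eq h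

theorem p_add_two (F : RatCF) (n : ℕ) :
    F.p (n + 2) = F.a (n + 2) * F.p (n + 1) + F.b (n + 1) * F.p n := by
  have h : F.toGenContFract.s.get? (n + 1) = some ⟨F.b (n + 1), F.a (n + 2)⟩ := rfl
  exact GenContFract.nums_recurrence h rfl rfl

theorem q_add_two (F : RatCF) (n : ℕ) :
    F.q (n + 2) = F.a (n + 2) * F.q (n + 1) + F.b (n + 1) * F.q n := by
  have h : F.toGenContFract.s.get? (n + 1) = some ⟨F.b (n + 1), F.a (n + 2)⟩ := rfl
  exact GenContFract.dens_recurrence h rfl rfl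

/-- The continued fraction converges to the real number `z`: the denominators `qₙ` are nonzero for
`n` sufficiently large, and `pₙ / qₙ` tends to `z`. -/
def ConvergesTo (F : RatCF) (z : ℝ) : Prop :=
  (∀ᶠ n in atTop, F.q n ≠ 0) ∧ Tendsto (fun n => (F.p n : ℝ) / (F.q n : ℝ)) atTop (𝓝 z)

/-- `aₙ = A(n)` and `bₙ = B(n)` for `n` sufficiently large. -/
def EventuallyGivenBy (F : RatCF) (A B : Polynomial ℚ) : Prop :=
  ∀ᶠ n : ℕ in atTop, F.a n = A.eval (n : ℚ) ∧ F.b n = B.eval (n : ℚ)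

end RatCF

/-- The pair of rational polynomials `(A, B)` represents `z`: there is a rational continued fraction
`(aₙ, bₙ)` converging to `z` such that `aₙ = A(n)` and `bₙ = B(n)` for `n` sufficiently large. -/
def Represents (A B : Polynomial ℚ) (z : ℝ) : Prop :=
  ∃ F : RatCF, F.ConvergesTo z ∧ F.EventuallyGivenBy A B

open Polynomial in
/-- `3n² + (8u+4v-3)n + (2u-1)(2u+2v-1)` as a polynomial in `n`. -/
noncomputable def polyA (u v : ℕ) : Polynomial ℚ :=
  C 3 * X ^ 2 + C (8 * (u : ℚ) + 4 * v - 3) * X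
    + C ((2 * (u : ℚ) - 1) * (2 * (u : ℚ) + 2 * v - 1))

open Polynomial in
/-- `-n(n+2u)(n+2u+2v)(2n+2u-2k-1)` as a polynomial in `n`. -/
noncomputable def polyB (u v k : ℕ) : Polynomial ℚ :=
  -(X * (X + C (2 * (u : ℚ))) * (X + C (2 * (u : ℚ) + 2 * v))
    * (C 2 * X + C (2 * (u : ℚ) - 2 * k - 1)))

/-! The proof is an induction on `k` at the level of the recurrence `x (n+2) = A(n+2) x (n+1) +
B(n+1) x n`. Since `A(n) ~ 3n²` and `B(n) ~ -2n⁴`, the characteristic roots are `2n²` and `n²`; the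
dominant solution serves as denominator.

For `k = 0` the recurrence has Euler's form: the product `eulerDen` is a solution, and a second one
is `eulerDen` times the partial sums of the hypergeometric series with terms `hyperTerm u v`.
Telescoping contiguous relations in `u` and `v` reduce the sum of that series to the case `u = v =
0`, where sine integrals give `π²/8`. So every such sum is `z + w π²` with `z`, `w` rational and `w
≠ 0`, and a rational affine change turns the limit into `π²`.

The step `k → k+1` is a Bauer–Muir transformation (`IsSol.bmTransform`). Its modifier behaves like
`-n²`, so it leaves the dominant solution dominant and keeps the limit of `p/q`, while the
difference of consecutive quotients, which is the Wronskian over `q n * q (n+1)`, gains exactly a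
factor of order `n⁻³` (`IsFundamental.bm`).

Finally, any admissible continued fraction has `p` and `q` eventually in the span of this
fundamental pair. This transfers the rate to its consecutive differences, and a Stolz–Cesàro
argument passes from differences to the error itself. -/

theorem polyA_eval (u v : ℕ) (t : ℚ) : (polyA u v).eval t =
    3 * t ^ 2 + (8 * u + 4 * v - 3) * t + (2 * u - 1) * (2 * u + 2 * v - 1) := by
  simp [polyA]

theorem polyB_eval (u v k : ℕ) (t : ℚ) : (polyB u v k).eval t =
    -(t * (t + 2 * u) * (t + (2 * u + 2 * v)) * (2 * t + (2 * u - 2 * k - 1))) := by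
  simp [polyB]

/-! ### The recurrence and its Wronskian. -/

/-- Solutions of the three-term recurrence attached to the pair `(polyA u v, polyB u v k)`. -/
def IsSol (u v k : ℕ) (x : ℕ → ℚ) : Prop :=
  ∀ n : ℕ, x (n + 2) = (polyA u v).eval ((n : ℚ) + 2) * x (n + 1) +
    (polyB u v k).eval ((n : ℚ) + 1) * x n

/-- The linear factor of `polyB u v k` that depends on `k`. -/
def linFactor (u k n : ℕ) : ℚ := 2 * n + 2 * u - 2 * k - 1

theorem linFactor_ne_zero (u k n : ℕ) : linFactor u k n ≠ 0 := by
  unfold linFactor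
  intro h
  have h2 : (2 * n + 2 * u : ℤ) - 2 * k - 1 = 0 := by exact_mod_cast h
  omega

/-- The factor depending on `k` may be negative but is an odd integer, hence nonzero. The argument
starts at 1 because `B(0) = 0`. -/
theorem polyB_eval_succ_ne_zero (u v k n : ℕ) : (polyB u v k).eval ((n : ℚ) + 1) ≠ 0 := by
  rw [polyB_eval]
  have h := linFactor_ne_zero u k (n + 1)
  unfold linFactor at h
  push_cast at h
  refine neg_ne_zero.2 (mul_ne_zero (by positivity) ?_)
  intro h'
  exact h (by linarith)

/-- The Wronskian of two sequences. -/
def wronskian (p q : ℕ → ℚ) (n : ℕ) : ℚ := p (n + 1) * q n - p n * q (n + 1)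

theorem IsSol.wronskian_succ {u v k : ℕ} {p q : ℕ → ℚ} (hp : IsSol u v k p) (hq : IsSol u v k q)
    (n : ℕ) : wronskian p q (n + 1) = -(polyB u v k).eval ((n : ℚ) + 1) * wronskian p q n := by
  simp only [wronskian, hp n, hq n]
  ring

theorem IsSol.wronskian_ne_zero {u v k : ℕ} {p q : ℕ → ℚ} (hp : IsSol u v k p)
    (hq : IsSol u v k q) (h0 : wronskian p q 0 ≠ 0) (n : ℕ) : wronskian p q n ≠ 0 := by
  induction n with
  | zero => exact h0
  | succ n ih =>
    rw [hp.wronskian_succ hq]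
    exact mul_ne_zero (neg_ne_zero.2 (polyB_eval_succ_ne_zero u v k n)) ih

/-! ### The Bauer–Muir transformation. -/

/-- The modifying polynomial of the Bauer–Muir transformation `k ↦ k + 1`. -/
def bmCoeff (u v k n : ℕ) : ℚ :=
  -(n : ℚ) ^ 2 + (2 * k + 2 - 2 * u) * n - 4 * (k + 1) * (k + 1 + v)

/-- The Bauer–Muir transformation from solutions for `k` to solutions for `k + 1`. -/
def bmTransform (u v k : ℕ) (x : ℕ → ℚ) (n : ℕ) : ℚ :=
  (x (n + 1) + bmCoeff u v k (n + 1) * x n) / linFactor u k n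

theorem bmTransform_mul (u v k : ℕ) (x : ℕ → ℚ) (n : ℕ) :
    bmTransform u v k x n * linFactor u k n = x (n + 1) + bmCoeff u v k (n + 1) * x n :=
  div_mul_cancel₀ _ (linFactor_ne_zero u k n)

/-- The modifier is chosen so that this factorization and the one in `bm_add_eq'` share the same
cofactor, which is what makes the transformed sequence satisfy a recurrence with the same `A`. -/
theorem bm_add_eq (u v k n : ℕ) :
    (polyA u v).eval ((n : ℚ) + 2) + bmCoeff u v k (n + 2) =
      linFactor u k (n + 1) * (n + 2 * u + 2 * k + 2 * v + 3) := by
  rw [polyA_eval]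
  simp only [bmCoeff, linFactor]
  push_cast
  ring

theorem bm_add_eq' (u v k n : ℕ) :
    (polyA u v).eval ((n : ℚ) + 1) + bmCoeff u v k n =
      linFactor u k n * (n + 2 * u + 2 * k + 2 * v + 3) := by
  rw [polyA_eval]
  simp only [bmCoeff, linFactor]
  ring

/-- This is the determinant of the linear map from `(x n, x (n+1))` to the numerators of two
consecutive transformed terms. Apart from the linear factor it is a nonzero constant, so linear
independence survives the transformation. -/
theorem bm_det (u v k n : ℕ) :
    bmCoeff u v k (n + 1) * ((polyA u v).eval ((n : ℚ) + 2) + bmCoeff u v k (n + 2)) -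
      (polyB u v k).eval ((n : ℚ) + 1) =
    -8 * (k + 1) * (k + 1 + v) * (k + 1 + u + v) * linFactor u k (n + 1) := by
  rw [polyA_eval, polyB_eval]
  simp only [bmCoeff, linFactor]
  push_cast
  ring

/-- Raising `k` by one shifts the index of the linear factor: `linFactor u (k+1) (n+1) = linFactor u
k n`. -/
theorem polyB_succ_mul (u v k n : ℕ) :
    (polyB u v (k + 1)).eval ((n : ℚ) + 1) * linFactor u k (n + 1) =
      (polyB u v k).eval ((n : ℚ) + 1) * linFactor u k n := by
  rw [polyB_eval, polyB_eval]
  simp only [linFactor]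
  push_cast
  ring

theorem IsSol.bmTransform {u v k : ℕ} {x : ℕ → ℚ} (hx : IsSol u v k x) :
    IsSol u v (k + 1) (bmTransform u v k x) := by
  intro n
  have h0 := linFactor_ne_zero u k n
  have h1 := linFactor_ne_zero u k (n + 1)
  have h2 := linFactor_ne_zero u k (n + 2)
  have e0 := bmTransform_mul u v k x n
  have e1 := bmTransform_mul u v k x (n + 1)
  have e2 := bmTransform_mul u v k x (n + 2)
  have r0 := hx n
  have r1 := hx (n + 1)
  have a1 := bm_add_eq u v k (n + 1)
  have a0 := bm_add_eq u v k n
  have b0 := bm_add_eq' u v k (n + 1)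
  have d0 := bm_det u v k n
  have d1 := bm_det u v k (n + 1)
  have B1 := polyB_succ_mul u v k n
  push_cast at r1 a1 b0 d1
  have c3 : (n : ℚ) + 1 + 2 = n + 3 := by ring
  have c2 : (n : ℚ) + 1 + 1 = n + 2 := by ring
  simp only [c3, c2, show n + 1 + 2 = n + 3 from rfl, show n + 1 + 1 = n + 2 from rfl] at *
  generalize (polyB u v (k + 1)).eval ((n : ℚ) + 1) = B' at *
  generalize (polyB u v k).eval ((n : ℚ) + 1) = B at *
  generalize (polyB u v k).eval ((n : ℚ) + 2) = B2 at *
  generalize (polyA u v).eval ((n : ℚ) + 2) = A at *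
  generalize (polyA u v).eval ((n : ℚ) + 3) = A3 at *
  generalize _root_.bmTransform u v k x n = y0 at *
  generalize _root_.bmTransform u v k x (n + 1) = y1 at *
  generalize _root_.bmTransform u v k x (n + 2) = y2 at *
  generalize bmCoeff u v k (n + 1) = s1 at *
  generalize bmCoeff u v k (n + 2) = s2 at *
  generalize bmCoeff u v k (n + 3) = s3 at *
  generalize linFactor u k n = l0 at *
  generalize linFactor u k (n + 1) = l1 at *
  generalize linFactor u k (n + 2) = l2 at *
  generalize x (n + 3) = x3 at *
  generalize x (n + 2) = x2 at *
  generalize x (n + 1) = x1 at *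
  generalize x n = x0 at *
  generalize (-8 * (k + 1) * (k + 1 + v) * (k + 1 + u + v) : ℚ) = c at *
  generalize ((n : ℚ) + 1 + 2 * u + 2 * k + 2 * v + 3) = h at *
  -- `f1` and `f2` are first-order relations between the old and the new sequence; adding them
  -- eliminates `x1` and leaves the recurrence for `y`.
  have f1 : y2 = (A + s1) * y1 - c * x1 := by
    apply mul_right_cancel₀ h2
    linear_combination e2 + r1 + (x2 + s2 * x1) * a1 - y1 * l2 * b0 - l2 * h * e1 - x1 * d1
  have f2 : s1 * y1 - c * x1 = B' * y0 := by
    apply mul_right_cancel₀ h1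
    linear_combination s1 * e1 + s1 * r0 + x1 * d0 - y0 * B1 - B * e0
  linear_combination f1 + f2

theorem wronskian_bmTransform {u v k : ℕ} {p q : ℕ → ℚ} (hp : IsSol u v k p)
    (hq : IsSol u v k q) (n : ℕ) :
    wronskian (bmTransform u v k p) (bmTransform u v k q) n * linFactor u k n =
      -8 * (k + 1) * (k + 1 + v) * (k + 1 + u + v) * wronskian p q n := by
  have h1 := linFactor_ne_zero u k (n + 1)
  have e0 := bmTransform_mul u v k p n
  have e1 := bmTransform_mul u v k p (n + 1)
  have f0 := bmTransform_mul u v k q n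
  have f1 := bmTransform_mul u v k q (n + 1)
  have d0 := bm_det u v k n
  rw [hp n] at e1
  rw [hq n] at f1
  apply mul_right_cancel₀ h1
  simp only [wronskian, show n + 1 + 1 = n + 2 from rfl] at *
  linear_combination (q (n + 1) + bmCoeff u v k (n + 1) * q n) * e1 -
    (p (n + 1) + bmCoeff u v k (n + 1) * p n) * f1 +
    (bmTransform u v k p (n + 1) * linFactor u k (n + 1)) * f0 -
    (bmTransform u v k q (n + 1) * linFactor u k (n + 1)) * e0 +
    (p (n + 1) * q n - p n * q (n + 1)) * d0

/-! ### The hypergeometric series and its contiguous relations. -/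

/-- The hypergeometric term `(1)ₙ (2u+1)ₙ / ((2u+2v+2)ₙ (u+3/2)ₙ 2ⁿ)`. -/
def hyperTerm (u v : ℕ) : ℕ → ℚ
  | 0 => 1
  | n + 1 => ((n + 1) * (n + 1 + 2 * u)) / ((n + 2 + 2 * u + 2 * v) * (2 * n + 2 * u + 3)) *
      hyperTerm u v n

theorem hyperTerm_pos (u v n : ℕ) : 0 < hyperTerm u v n := by
  induction n with
  | zero => simp [hyperTerm]
  | succ n ih => rw [hyperTerm]; positivity

theorem hyperTerm_succ (u v n : ℕ) : hyperTerm u v (n + 1) =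
    ((n + 1) * (n + 1 + 2 * u)) / ((n + 2 + 2 * u + 2 * v) * (2 * n + 2 * u + 3)) *
      hyperTerm u v n := rfl

theorem hyperTerm_le (u v n : ℕ) : hyperTerm u v n ≤ (1 / 2) ^ n := by
  induction n with
  | zero => simp [hyperTerm]
  | succ n ih =>
    rw [hyperTerm_succ, pow_succ']
    refine mul_le_mul ?_ ih (hyperTerm_pos u v n).le (by norm_num)
    rw [div_le_div_iff₀ (by positivity) (by norm_num)]
    have : (0 : ℚ) ≤ n := by positivity
    have : (0 : ℚ) ≤ u := by positivity
    have : (0 : ℚ) ≤ v := by positivity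
    nlinarith [mul_nonneg ‹(0 : ℚ) ≤ n› ‹(0 : ℚ) ≤ u›, mul_nonneg ‹(0 : ℚ) ≤ n› ‹(0 : ℚ) ≤ v›,
      mul_nonneg ‹(0 : ℚ) ≤ u› ‹(0 : ℚ) ≤ v›, mul_nonneg ‹(0 : ℚ) ≤ u› ‹(0 : ℚ) ≤ u›]

theorem hyperTerm_le_real (u v n : ℕ) : (hyperTerm u v n : ℝ) ≤ (1 / 2) ^ n := by
  have h : ((hyperTerm u v n : ℚ) : ℝ) ≤ (((1 / 2) ^ n : ℚ) : ℝ) := by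
    exact_mod_cast hyperTerm_le u v n
  simpa using h

theorem hyperTerm_pos_real (u v n : ℕ) : 0 < (hyperTerm u v n : ℝ) := by
  exact_mod_cast hyperTerm_pos u v n

theorem summable_hyperTerm (u v : ℕ) : Summable fun n => (hyperTerm u v n : ℝ) :=
  Summable.of_nonneg_of_le (fun n => (hyperTerm_pos_real u v n).le) (hyperTerm_le_real u v)
    summable_geometric_two

theorem tendsto_hyperTerm (u v : ℕ) :
    Tendsto (fun n => (hyperTerm u v n : ℝ)) atTop (𝓝 0) :=
  (summable_hyperTerm u v).tendsto_atTop_zero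

theorem tendsto_pow_mul_hyperTerm (u v m : ℕ) :
    Tendsto (fun n : ℕ => (n : ℝ) ^ m * (hyperTerm u v n : ℝ)) atTop (𝓝 0) := by
  refine squeeze_zero (fun n => mul_nonneg (by positivity) (hyperTerm_pos_real u v n).le)
    (fun n => mul_le_mul_of_nonneg_left (hyperTerm_le_real u v n) (by positivity)) ?_
  exact tendsto_pow_const_mul_const_pow_of_abs_lt_one m (by rw [abs_of_pos] <;> norm_num)

/-- Summation of a telescoping series. -/
theorem tsum_eq_of_telescope {f G : ℕ → ℝ} (hf : Summable f) (hG : Tendsto G atTop (𝓝 0))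
    (h : ∀ n, f n = G (n + 1) - G n) : ∑' n, f n = -G 0 := by
  refine tendsto_nhds_unique hf.hasSum.tendsto_sum_nat ?_
  simp only [h, Finset.sum_range_sub]
  simpa using hG.sub_const (G 0)

theorem hyperTerm_succ_right (u v n : ℕ) :
    hyperTerm u (v + 1) n * ((n + 2 * u + 2 * v + 2) * (n + 2 * u + 2 * v + 3)) =
      hyperTerm u v n * ((2 * u + 2 * v + 2) * (2 * u + 2 * v + 3)) := by
  induction n with
  | zero => simp [hyperTerm]
  | succ n ih =>
    rw [hyperTerm_succ, hyperTerm_succ]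
    push_cast
    have e : hyperTerm u (v + 1) n = hyperTerm u v n * ((2 * u + 2 * v + 2) * (2 * u + 2 * v + 3)) /
      ((n + 2 * u + 2 * v + 2) * (n + 2 * u + 2 * v + 3)) := by
      rw [← ih]; field_simp
    rw [e]
    field_simp
    ring

/-- The comparison is with `v + 1` because both terms then have the same denominator parameter
`2u+2v+4`. -/
theorem hyperTerm_succ_left (u v n : ℕ) :
    hyperTerm (u + 1) v n * ((2 * u + 1) * (2 * u + 2) * (2 * n + 2 * u + 3)) =
      hyperTerm u (v + 1) n * ((n + 2 * u + 1) * (n + 2 * u + 2) * (2 * u + 3)) := by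
  induction n with
  | zero => simp [hyperTerm]
  | succ n ih =>
    rw [hyperTerm_succ, hyperTerm_succ]
    push_cast
    have e : hyperTerm (u + 1) v n =
        hyperTerm u (v + 1) n * ((n + 2 * u + 1) * (n + 2 * u + 2) * (2 * u + 3)) /
          ((2 * u + 1) * (2 * u + 2) * (2 * n + 2 * u + 3)) := by
      rw [← ih]; field_simp
    rw [e]
    field_simp
    ring

/-- The difference of the two summands telescopes, with a rational multiple of `hyperTerm u v n` as
certificate `G`. The coefficient `2v+2` is nonzero, so the relation can be solved for the sum at `v
+ 1`. -/
theorem tsum_hyperTerm_right (u v : ℕ) :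
    ∑' n, (hyperTerm u v n : ℝ) =
      (2 * v + 2) / (2 * u + 2 * v + 3) * ∑' n, (hyperTerm u (v + 1) n : ℝ) +
        (2 * u + 1) / (2 * u + 2 * v + 2) := by
  have key := tsum_eq_of_telescope
    (f := fun n => (hyperTerm u v n : ℝ) -
      (2 * v + 2) / (2 * u + 2 * v + 3) * (hyperTerm u (v + 1) n : ℝ))
    (G := fun n => -((2 * n + 2 * u + 1) / (n + 2 * u + 2 * v + 2)) * (hyperTerm u v n : ℝ))
    ((summable_hyperTerm u v).sub ((summable_hyperTerm u (v + 1)).mul_left _)) ?_ ?_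
  · rw [(summable_hyperTerm u v).tsum_sub ((summable_hyperTerm u (v + 1)).mul_left _),
      tsum_mul_left] at key
    simp only [hyperTerm, CharP.cast_eq_zero] at key
    push_cast at key
    ring_nf at key ⊢
    linarith
  · have hb : Tendsto (fun n => 2 * (hyperTerm u v n : ℝ)) atTop (𝓝 0) := by
      simpa using (tendsto_hyperTerm u v).const_mul 2
    refine squeeze_zero_norm (fun n => ?_) hb
    rw [norm_mul, norm_neg, Real.norm_of_nonneg (hyperTerm_pos_real u v n).le,
      Real.norm_of_nonneg (by positivity)]
    refine mul_le_mul_of_nonneg_right ?_ (hyperTerm_pos_real u v n).le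
    rw [div_le_iff₀ (by positivity)]
    have : (0 : ℝ) ≤ v := by positivity
    have : (0 : ℝ) ≤ u := by positivity
    linarith
  · intro n
    have e : (hyperTerm u (v + 1) n : ℝ) * ((n + 2 * u + 2 * v + 2) * (n + 2 * u + 2 * v + 3)) =
        hyperTerm u v n * ((2 * u + 2 * v + 2) * (2 * u + 2 * v + 3)) := by
      exact_mod_cast hyperTerm_succ_right u v n
    have e' : (hyperTerm u (v + 1) n : ℝ) =
        hyperTerm u v n * ((2 * u + 2 * v + 2) * (2 * u + 2 * v + 3)) /
        ((n + 2 * u + 2 * v + 2) * (n + 2 * u + 2 * v + 3)) := by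
      rw [← e]; field_simp
    rw [e', hyperTerm_succ]
    push_cast
    field_simp
    ring

theorem tsum_hyperTerm_left (u v : ℕ) :
    (2 * u + 1) * (2 * u + 2) / (2 * u + 3) * ∑' n, (hyperTerm (u + 1) v n : ℝ) +
      2 * (v + 1) * ∑' n, (hyperTerm u (v + 1) n : ℝ) = 2 * u + 2 * v + 3 := by
  have key := tsum_eq_of_telescope
    (f := fun n => (2 * u + 1) * (2 * u + 2) / (2 * u + 3) * (hyperTerm (u + 1) v n : ℝ) +
      2 * (v + 1) * (hyperTerm u (v + 1) n : ℝ))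
    (G := fun n => -(n + 2 * u + 2 * v + 3) * (hyperTerm u (v + 1) n : ℝ))
    (((summable_hyperTerm (u + 1) v).mul_left _).add
      ((summable_hyperTerm u (v + 1)).mul_left _)) ?_ ?_
  · rw [((summable_hyperTerm (u + 1) v).mul_left _).tsum_add
      ((summable_hyperTerm u (v + 1)).mul_left _), tsum_mul_left, tsum_mul_left] at key
    rw [key]
    simp [hyperTerm]
  · have := ((tendsto_pow_mul_hyperTerm u (v + 1) 1).add
      ((tendsto_hyperTerm u (v + 1)).const_mul (2 * u + 2 * v + 3 : ℝ))).neg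
    simp only [mul_zero, add_zero, neg_zero] at this
    refine this.congr fun n => ?_
    ring
  · intro n
    have e : (hyperTerm (u + 1) v n : ℝ) * ((2 * u + 1) * (2 * u + 2) * (2 * n + 2 * u + 3)) =
      hyperTerm u (v + 1) n * ((n + 2 * u + 1) * (n + 2 * u + 2) * (2 * u + 3)) := by
      exact_mod_cast hyperTerm_succ_left u v n
    have e' : (hyperTerm (u + 1) v n : ℝ) =
        hyperTerm u (v + 1) n * ((n + 2 * u + 1) * (n + 2 * u + 2) * (2 * u + 3)) /
          ((2 * u + 1) * (2 * u + 2) * (2 * n + 2 * u + 3)) := by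
      rw [← e]; field_simp
    rw [e', hyperTerm_succ]
    push_cast
    field_simp
    ring

/-! ### The base sum `π²/8` through sine integrals. -/

open Real in
/-- The integrals `∫₀^{π/4} (π/4 - x) sin^{2n} x dx`. -/
noncomputable def sinMoment (n : ℕ) : ℝ := ∫ x in (0 : ℝ)..(π / 4), (π / 4 - x) * sin x ^ (2 * n)

open Real in
theorem sinMoment_zero : sinMoment 0 = π ^ 2 / 32 := by
  simp only [sinMoment, mul_zero, pow_zero, mul_one]
  rw [intervalIntegral.integral_sub (Continuous.intervalIntegrable (by fun_prop) _ _)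
    (Continuous.intervalIntegrable (by fun_prop) _ _), intervalIntegral.integral_const, integral_id,
    smul_eq_mul]
  ring

open Real in
theorem sin_sq_pi_div_four : sin (π / 4) ^ 2 = 1 / 2 := by
  rw [sin_pi_div_four, div_pow, Real.sq_sqrt (by norm_num)]
  norm_num

-- Integration by parts: in the antiderivative below the factor `π/4 - x` vanishes at the upper end,
-- so only `sin (π/4) ^ (2n+2) = 2^{-(n+1)}` contributes.
open Real in
theorem sinMoment_succ (n : ℕ) : (2 * n + 2) * sinMoment (n + 1) - (2 * n + 1) * sinMoment n =
    -((1 / 2) ^ (n + 1) / (2 * n + 2)) := by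
  have hd : ∀ x ∈ Set.uIcc (0 : ℝ) (π / 4), HasDerivAt
      (fun x => -(π / 4 - x) * (sin x ^ (2 * n + 1) * cos x) - sin x ^ (2 * n + 2) / (2 * n + 2))
      ((2 * n + 2) * ((π / 4 - x) * sin x ^ (2 * (n + 1))) -
        (2 * n + 1) * ((π / 4 - x) * sin x ^ (2 * n))) x := by
    intro x _
    have h1 := (((hasDerivAt_id x).const_sub (π / 4)).neg).mul
      (((hasDerivAt_sin x).pow (2 * n + 1)).mul (hasDerivAt_cos x))
    have h2 := ((hasDerivAt_sin x).pow (2 * n + 2)).div_const (2 * (n : ℝ) + 2)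
    refine (h1.sub h2).congr_deriv ?_
    have hc : cos x * cos x = 1 - sin x ^ 2 := by rw [← sq, cos_sq']
    simp only [id, Nat.add_sub_cancel, show 2 * n + 2 - 1 = 2 * n + 1 from rfl, Pi.mul_apply,
      Pi.pow_apply, Pi.neg_apply]
    push_cast
    have hn : (2 * (n : ℝ) + 2) ≠ 0 := by positivity
    field_simp
    rw [show 2 * (n + 1) = 2 * n + 2 from rfl]
    simp only [pow_succ]
    linear_combination (-(π - 4 * x) * (2 * n + 1) * sin x ^ (2 * n)) * hc
  have hint : IntervalIntegrable (fun x => (2 * n + 2) * ((π / 4 - x) * sin x ^ (2 * (n + 1))) -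
        (2 * n + 1) * ((π / 4 - x) * sin x ^ (2 * n))) MeasureTheory.volume 0 (π / 4) :=
    Continuous.intervalIntegrable (by fun_prop) _ _
  have h := intervalIntegral.integral_eq_sub_of_hasDerivAt hd hint
  rw [intervalIntegral.integral_sub (Continuous.intervalIntegrable (by fun_prop) _ _)
    (Continuous.intervalIntegrable (by fun_prop) _ _), intervalIntegral.integral_const_mul,
    intervalIntegral.integral_const_mul] at h
  unfold sinMoment
  rw [h, show 2 * n + 2 = 2 * (n + 1) by ring, pow_mul (sin (π / 4)), sin_sq_pi_div_four]
  simp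

open Real in
theorem sinMoment_nonneg (n : ℕ) : 0 ≤ sinMoment n := by
  refine intervalIntegral.integral_nonneg (by positivity) fun x hx => ?_
  exact mul_nonneg (by linarith [hx.2]) ((even_two_mul n).pow_nonneg _)

open Real in
theorem sinMoment_le (n : ℕ) : sinMoment n ≤ (1 / 2) ^ n := by
  have h : ∀ x ∈ Set.Icc (0 : ℝ) (π / 4), (π / 4 - x) * sin x ^ (2 * n) ≤ (1 / 2) ^ n := by
    intro x hx
    have h1 : sin x ^ 2 ≤ 1 / 2 := by
      rw [← sin_sq_pi_div_four]
      have h0 : 0 ≤ sin x := sin_nonneg_of_nonneg_of_le_pi hx.1 (by linarith [hx.2, pi_pos])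
      have := sin_le_sin_of_le_of_le_pi_div_two (by linarith [hx.1, pi_pos])
        (by linarith [pi_pos]) hx.2
      gcongr
    have h2 : sin x ^ (2 * n) ≤ (1 / 2) ^ n := by
      rw [pow_mul]; gcongr
    calc (π / 4 - x) * sin x ^ (2 * n) ≤ 1 * (1 / 2) ^ n := by
          refine mul_le_mul (by linarith [hx.1, pi_lt_four]) h2
            ((even_two_mul n).pow_nonneg _) zero_le_one
      _ = _ := one_mul _
  have := intervalIntegral.integral_mono_on (μ := MeasureTheory.volume) (a := 0) (b := π / 4)
    (by positivity) (Continuous.intervalIntegrable (by fun_prop) _ _)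
    (Continuous.intervalIntegrable (by fun_prop) _ _) h
  refine this.trans ?_
  rw [intervalIntegral.integral_const, smul_eq_mul, sub_zero]
  have : π / 4 ≤ 1 := by linarith [pi_lt_four]
  have h3 : (0 : ℝ) ≤ (1 / 2) ^ n := by positivity
  nlinarith

theorem hyperTerm_zero_zero_succ (n : ℕ) : (hyperTerm 0 0 (n + 1) : ℝ) =
    (n + 1) * (n + 1) / ((n + 2) * (2 * n + 3)) * hyperTerm 0 0 n := by
  rw [hyperTerm_succ]; push_cast; ring

open Real in
theorem tsum_hyperTerm_zero : ∑' n, (hyperTerm 0 0 n : ℝ) = π ^ 2 / 8 := by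
  have key := tsum_eq_of_telescope (f := fun n => (hyperTerm 0 0 n : ℝ))
    -- The weight is the summation factor that turns `sinMoment_succ` into a telescoping identity:
    -- its inhomogeneous term, multiplied by the weight, becomes exactly `hyperTerm 0 0 n`.
    (G := fun n => -(4 * (2 : ℝ) ^ n * ((n + 1) * (2 * n + 1)) * hyperTerm 0 0 n * sinMoment n))
    (summable_hyperTerm 0 0) ?_ ?_
  · rw [key]
    simp only [sinMoment_zero, hyperTerm, CharP.cast_eq_zero]
    push_cast
    ring
  · have hb : Tendsto (fun n : ℕ => 4 * (((n + 1 : ℝ) * (2 * n + 1)) * hyperTerm 0 0 n)) atTop (𝓝 0) := by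
      have := (((tendsto_pow_mul_hyperTerm 0 0 2).const_mul 2).add
        (((tendsto_pow_mul_hyperTerm 0 0 1).const_mul 3).add (tendsto_hyperTerm 0 0))).const_mul 4
      simp only [mul_zero, add_zero] at this
      refine this.congr fun n => ?_
      ring
    refine squeeze_zero_norm (fun n => ?_) hb
    have h0 := sinMoment_nonneg n
    have h1 := sinMoment_le n
    have h2 := hyperTerm_pos_real 0 0 n
    rw [norm_neg, Real.norm_of_nonneg (by positivity)]
    have h3 : (2 : ℝ) ^ n * sinMoment n ≤ 1 := by
      calc (2 : ℝ) ^ n * sinMoment n ≤ 2 ^ n * (1 / 2) ^ n := by gcongr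
        _ = 1 := by rw [← mul_pow]; norm_num
    calc 4 * (2 : ℝ) ^ n * ((n + 1) * (2 * n + 1)) * hyperTerm 0 0 n * sinMoment n
        = 4 * (((n + 1 : ℝ) * (2 * n + 1)) * hyperTerm 0 0 n) * (2 ^ n * sinMoment n) := by ring
      _ ≤ 4 * (((n + 1 : ℝ) * (2 * n + 1)) * hyperTerm 0 0 n) * 1 := by gcongr
      _ = _ := mul_one _
  · intro n
    have h := sinMoment_succ n
    have e : sinMoment (n + 1) =
        ((2 * n + 1) * sinMoment n - (1 / 2) ^ (n + 1) / (2 * n + 2)) / (2 * n + 2) := by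
      rw [eq_div_iff (by positivity)]
      linarith
    have e2 : (2 : ℝ) ^ n * (1 / 2) ^ n = 1 := by rw [← mul_pow]; norm_num
    rw [hyperTerm_zero_zero_succ, e, pow_succ (1 / 2 : ℝ), pow_succ]
    generalize ((1 / 2 : ℝ) ^ n) = a at *
    have ha : a = 1 / 2 ^ n := by field_simp; linarith
    rw [ha]
    push_cast
    field_simp
    ring

/-- The hypergeometric sums are rational affine functions of `π²`. -/
theorem exists_tsum_hyperTerm (u v : ℕ) : ∃ z w : ℚ, w ≠ 0 ∧
    ∑' n, (hyperTerm u v n : ℝ) = z + w * Real.pi ^ 2 := by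
  -- Raising `u` by one uses the sum at `v + 1`, so the hypothesis must hold for all `v`. Both
  -- contiguous relations have nonzero coefficients, which preserves `w ≠ 0`.
  induction u generalizing v with
  | zero =>
    induction v with
    | zero =>
      refine ⟨0, 1 / 8, by norm_num, ?_⟩
      rw [tsum_hyperTerm_zero]
      push_cast
      ring
    | succ v ih =>
      obtain ⟨z, w, hw, h⟩ := ih
      rw [tsum_hyperTerm_right] at h
      refine ⟨(z - 1 / (2 * v + 2)) * (2 * v + 3) / (2 * v + 2),
        w * (2 * v + 3) / (2 * v + 2), by positivity, ?_⟩
      push_cast at h ⊢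
      generalize ∑' n, (hyperTerm 0 (v + 1) n : ℝ) = S at *
      field_simp at h ⊢
      linear_combination h
  | succ u ih =>
    obtain ⟨z, w, hw, h⟩ := ih (v + 1)
    have k := tsum_hyperTerm_left u v
    rw [h] at k
    refine ⟨(2 * u + 2 * v + 3 - 2 * (v + 1) * z) * (2 * u + 3) / ((2 * u + 1) * (2 * u + 2)),
      -(2 * (v + 1) * w * (2 * u + 3) / ((2 * u + 1) * (2 * u + 2))),
      neg_ne_zero.2 (by positivity), ?_⟩
    push_cast
    generalize ∑' n, (hyperTerm (u + 1) v n : ℝ) = S at *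
    field_simp at k ⊢
    linear_combination k

/-! ### Asymptotics of the hypergeometric term. -/

theorem tendsto_succ_div_self : Tendsto (fun n : ℕ => ((n : ℝ) + 1) / n) atTop (𝓝 1) := by
  have h := (tendsto_const_nhds (x := (1 : ℝ))).add (tendsto_one_div_atTop_nhds_zero_nat (𝕜 := ℝ))
  rw [add_zero] at h
  refine h.congr' ?_
  filter_upwards [eventually_gt_atTop 0] with n hn
  have : (n : ℝ) ≠ 0 := by positivity
  field_simp

theorem tendsto_succ_rpow_div (σ : ℝ) :
    Tendsto (fun n : ℕ => ((n : ℝ) + 1) ^ σ / (n : ℝ) ^ σ) atTop (𝓝 1) := by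
  have h := tendsto_succ_div_self.rpow_const (p := σ) (Or.inl one_ne_zero)
  rw [Real.one_rpow] at h
  refine h.congr fun n => ?_
  rw [Real.div_rpow (by positivity) (by positivity)]

theorem hyperTerm_succ_eq_prod (u v n : ℕ) : (hyperTerm u v (n + 1) : ℝ) * 2 ^ (n + 1) =
    (∏ j ∈ Finset.range (n + 1), ((1 : ℝ) + j)) *
      (∏ j ∈ Finset.range (n + 1), ((2 * u + 1 : ℝ) + j)) /
    ((∏ j ∈ Finset.range (n + 1), ((2 * u + 2 * v + 2 : ℝ) + j)) *
      ∏ j ∈ Finset.range (n + 1), ((u + 3 / 2 : ℝ) + j)) := by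
  have step : ∀ m : ℕ, (hyperTerm u v m : ℝ) * 2 ^ m =
    (∏ j ∈ Finset.range m, ((1 : ℝ) + j)) *
      (∏ j ∈ Finset.range m, ((2 * u + 1 : ℝ) + j)) /
    ((∏ j ∈ Finset.range m, ((2 * u + 2 * v + 2 : ℝ) + j)) *
      ∏ j ∈ Finset.range m, ((u + 3 / 2 : ℝ) + j)) := by
    intro m
    induction m with
    | zero => simp [hyperTerm]
    | succ m ih =>
      simp only [Finset.prod_range_succ]
      rw [hyperTerm_succ]
      push_cast
      rw [show ∀ a b c d e f g h : ℝ, a * b * (c * d) / (e * f * (g * h)) =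
        (a * c / (e * g)) * (b * d / (f * h)) from fun a b c d e f g h => by
          rw [div_mul_div_comm]; ring_nf, ← ih]
      field_simp
      ring
  exact step (n + 1)

theorem tendsto_hyperTerm_mul (u v : ℕ) : ∃ κ : ℝ, κ ≠ 0 ∧
    Tendsto (fun n : ℕ => (hyperTerm u v n : ℝ) * 2 ^ n * (n : ℝ) ^ ((u : ℝ) + 2 * v + 3 / 2))
      atTop (𝓝 κ) := by
  have g1 := Real.GammaSeq_tendsto_Gamma 1
  have g2 := Real.GammaSeq_tendsto_Gamma (2 * u + 1)
  have g3 := Real.GammaSeq_tendsto_Gamma (2 * u + 2 * v + 2)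
  have g4 := Real.GammaSeq_tendsto_Gamma (u + 3 / 2)
  have p1 : 0 < Real.Gamma 1 := Real.Gamma_pos_of_pos (by positivity)
  have p2 : 0 < Real.Gamma (2 * u + 1) := Real.Gamma_pos_of_pos (by positivity)
  have p3 : 0 < Real.Gamma (2 * u + 2 * v + 2) := Real.Gamma_pos_of_pos (by positivity)
  have p4 : 0 < Real.Gamma (u + 3 / 2) := Real.Gamma_pos_of_pos (by positivity)
  -- Gauss's product for Γ: the factorials cancel, and the exponent is `(2u+2v+2) + (u+3/2) - 1 -
  -- (2u+1)`. `GammaSeq` at `n` has `n + 1` factors, so it describes the term at `n + 1`, and the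
  -- last factor replaces `n` by `n + 1` in the power.
  have g := ((g3.mul g4).div (g1.mul g2) (by positivity)).mul
    (tendsto_succ_rpow_div ((u : ℝ) + 2 * v + 3 / 2))
  refine ⟨_, ?_, (tendsto_add_atTop_iff_nat 1).1 (g.congr' ?_)⟩
  · positivity
  filter_upwards [eventually_gt_atTop 0] with n hn
  have hn' : (0 : ℝ) < n := by positivity
  rw [hyperTerm_succ_eq_prod]
  simp only [Real.GammaSeq, Pi.div_apply]
  have q1 : 0 < ∏ j ∈ Finset.range (n + 1), ((1 : ℝ) + j) :=
    Finset.prod_pos fun j _ => by positivity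
  have q2 : 0 < ∏ j ∈ Finset.range (n + 1), ((2 * u + 1 : ℝ) + j) :=
    Finset.prod_pos fun j _ => by positivity
  have q3 : 0 < ∏ j ∈ Finset.range (n + 1), ((2 * u + 2 * v + 2 : ℝ) + j) :=
    Finset.prod_pos fun j _ => by positivity
  have q4 : 0 < ∏ j ∈ Finset.range (n + 1), ((u + 3 / 2 : ℝ) + j) :=
    Finset.prod_pos fun j _ => by positivity
  have hf : (0 : ℝ) < (n.factorial : ℝ) := by positivity
  have e : (n : ℝ) ^ (2 * u + 2 * v + 2 : ℝ) * (n : ℝ) ^ (u + 3 / 2 : ℝ) =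
      (n : ℝ) ^ (1 : ℝ) * (n : ℝ) ^ (2 * u + 1 : ℝ) * (n : ℝ) ^ ((u : ℝ) + 2 * v + 3 / 2) := by
    rw [← Real.rpow_add hn', ← Real.rpow_add hn', ← Real.rpow_add hn']
    congr 1
    ring
  push_cast
  have r1 := Real.rpow_pos_of_pos hn' 1
  have r2 := Real.rpow_pos_of_pos hn' (2 * u + 1)
  have r3 := Real.rpow_pos_of_pos hn' ((u : ℝ) + 2 * v + 3 / 2)
  generalize (n : ℝ) ^ (2 * u + 2 * v + 2 : ℝ) = x3 at *
  generalize (n : ℝ) ^ (u + 3 / 2 : ℝ) = x4 at *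
  generalize (n : ℝ) ^ (1 : ℝ) = x1 at *
  generalize (n : ℝ) ^ (2 * u + 1 : ℝ) = x2 at *
  generalize (n : ℝ) ^ ((u : ℝ) + 2 * v + 3 / 2) = x5 at *
  generalize ((n : ℝ) + 1) ^ ((u : ℝ) + 2 * v + 3 / 2) = x6 at *
  generalize ∏ j ∈ Finset.range (n + 1), ((1 : ℝ) + j) = y1 at *
  generalize ∏ j ∈ Finset.range (n + 1), ((2 * u + 1 : ℝ) + j) = y2 at *
  generalize ∏ j ∈ Finset.range (n + 1), ((2 * u + 2 * v + 2 : ℝ) + j) = y3 at *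
  generalize ∏ j ∈ Finset.range (n + 1), ((u + 3 / 2 : ℝ) + j) = y4 at *
  field_simp
  linear_combination x6 * e

/-! ### Fundamental pairs for every `k`. -/

/-- A pair of rational solutions of the recurrence, linearly independent, whose quotient tends to
`π²` at the exact rate `2⁻ⁿ n^{-(u+2v+3/2+3k)}`. -/
structure IsFundamental (u v k : ℕ) (p q : ℕ → ℚ) : Prop where
  num : IsSol u v k p
  den : IsSol u v k q
  wronskian_ne : wronskian p q 0 ≠ 0
  growth : Tendsto (fun n : ℕ => (q (n + 1) : ℝ) / ((n : ℝ) ^ 2 * q n)) atTop (𝓝 2)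
  tendsto : Tendsto (fun n : ℕ => (p n : ℝ) / q n) atTop (𝓝 (Real.pi ^ 2))
  rate : ∃ κ : ℝ, κ ≠ 0 ∧ Tendsto (fun n : ℕ => ((wronskian p q n : ℝ) / (q n * q (n + 1))) *
    2 ^ n * (n : ℝ) ^ ((u : ℝ) + 2 * v + 3 / 2 + 3 * k)) atTop (𝓝 κ)

/-- The dominant solution for `k = 0`. -/
def eulerDen (u v : ℕ) (n : ℕ) : ℚ :=
  ∏ j ∈ Finset.range n, (((j : ℚ) + 1 + 2 * u + 2 * v) * (2 * j + 2 * u + 1))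

theorem eulerDen_pos (u v n : ℕ) : 0 < eulerDen u v n :=
  Finset.prod_pos fun j _ => by positivity

theorem eulerDen_succ (u v n : ℕ) : eulerDen u v (n + 1) =
    eulerDen u v n * (((n : ℚ) + 1 + 2 * u + 2 * v) * (2 * n + 2 * u + 1)) :=
  Finset.prod_range_succ _ _

/-- With `r(n) = (n+2u+2v)(2n+2u-1)`, for `k = 0` one has `A(n) = r(n) + (n-1)(n-1+2u)` and `B(n) =
-n(n+2u) r(n)`. -/
theorem isSol_eulerDen (u v : ℕ) : IsSol u v 0 (eulerDen u v) := by
  intro n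
  rw [eulerDen_succ, eulerDen_succ, polyA_eval, polyB_eval]
  push_cast
  ring

theorem isSol_eulerDen_mul (u v : ℕ) {s : ℕ → ℚ} {w : ℚ}
    (hs : ∀ n, s (n + 1) = s n + hyperTerm u v n / w) :
    IsSol u v 0 (fun n => eulerDen u v n * s n) := by
  intro n
  simp only
  rw [hs (n + 1), hs n, hyperTerm_succ, isSol_eulerDen u v n, eulerDen_succ, polyA_eval,
    polyB_eval]
  push_cast
  field_simp
  ring

theorem exists_isFundamental_zero (u v : ℕ) : ∃ p q, IsFundamental u v 0 p q := by
  obtain ⟨z, w, hw, h⟩ := exists_tsum_hyperTerm u v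
  obtain ⟨κ, hκ, hlim⟩ := tendsto_hyperTerm_mul u v
  have hw' : (w : ℝ) ≠ 0 := by exact_mod_cast hw
  -- Subtracting `z` and dividing by `w` moves the limit `z + w π²` of the partial sums to `π²`
  -- within the rationals.
  set s : ℕ → ℚ := fun n => (∑ j ∈ Finset.range n, hyperTerm u v j - z) / w with hs
  have hs1 : ∀ n, s (n + 1) = s n + hyperTerm u v n / w := by
    intro n
    simp only [hs, Finset.sum_range_succ]
    ring
  have hW : ∀ n, wronskian (fun n => eulerDen u v n * s n) (eulerDen u v) n =
      eulerDen u v n * eulerDen u v (n + 1) * (hyperTerm u v n / w) := by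
    intro n
    simp only [wronskian, hs1]
    ring
  have hq : ∀ n, (eulerDen u v n : ℝ) ≠ 0 := fun n => by exact_mod_cast (eulerDen_pos u v n).ne'
  refine ⟨fun n => eulerDen u v n * s n, eulerDen u v, isSol_eulerDen_mul u v hs1,
    isSol_eulerDen u v, ?_, ?_, ?_, κ / w, div_ne_zero hκ hw', ?_⟩
  · rw [hW]
    exact mul_ne_zero (mul_pos (eulerDen_pos _ _ _) (eulerDen_pos _ _ _)).ne'
      (div_ne_zero (hyperTerm_pos _ _ _).ne' hw)
  · have i := tendsto_one_div_atTop_nhds_zero_nat (𝕜 := ℝ)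
    have l := ((i.const_mul (1 + 2 * u + 2 * v : ℝ)).const_add 1).mul
      ((i.const_mul (2 * u + 1 : ℝ)).const_add 2)
    simp only [mul_zero, add_zero, one_mul] at l
    refine l.congr' ?_
    filter_upwards [eventually_gt_atTop 0] with n hn
    have hn' : (n : ℝ) ≠ 0 := by positivity
    have := hq n
    rw [eulerDen_succ]
    push_cast
    field_simp
    ring
  · have hl := (((summable_hyperTerm u v).hasSum.tendsto_sum_nat).sub_const (z : ℝ)).div_const
      (w : ℝ)
    rw [h, add_sub_cancel_left, mul_div_cancel_left₀ _ hw'] at hl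
    refine hl.congr fun n => ?_
    have := hq n
    push_cast [hs]
    field_simp
  · refine (hlim.div_const (w : ℝ)).congr fun n => ?_
    have := hq n
    have := hq (n + 1)
    rw [hW]
    push_cast
    simp only [mul_zero, add_zero]
    field_simp

/-- Division by zero gives 0, whereas the quotient in `growth` tends to 2. -/
theorem IsFundamental.eventually_ne {u v k : ℕ} {p q : ℕ → ℚ} (h : IsFundamental u v k p q) :
    ∀ᶠ n in atTop, (q n : ℝ) ≠ 0 := by
  filter_upwards [h.growth.eventually_ne two_ne_zero] with n hn h0
  simp [h0] at hn

theorem tendsto_bmCoeff (u v k : ℕ) :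
    Tendsto (fun n : ℕ => (bmCoeff u v k (n + 1) : ℝ) / (n : ℝ) ^ 2) atTop (𝓝 (-1)) := by
  have i := tendsto_one_div_atTop_nhds_zero_nat (𝕜 := ℝ)
  have l := (((i.mul i).const_mul (-1 + (2 * k + 2 - 2 * u) - 4 * (k + 1) * (k + 1 + v) : ℝ)).add
    (i.const_mul (-2 + (2 * k + 2 - 2 * u) : ℝ))).const_add (-1)
  simp only [mul_zero, add_zero] at l
  refine l.congr' ?_
  filter_upwards [eventually_gt_atTop 0] with n hn
  have hn' : (n : ℝ) ≠ 0 := by positivity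
  simp only [bmCoeff]
  push_cast
  field_simp
  ring

theorem tendsto_linFactor (u k : ℕ) :
    Tendsto (fun n : ℕ => (linFactor u k n : ℝ) / n) atTop (𝓝 2) := by
  have i := tendsto_one_div_atTop_nhds_zero_nat (𝕜 := ℝ)
  have l := (i.const_mul (2 * u - 2 * k - 1 : ℝ)).const_add 2
  simp only [mul_zero, add_zero] at l
  refine l.congr' ?_
  filter_upwards [eventually_gt_atTop 0] with n hn
  have hn' : (n : ℝ) ≠ 0 := by positivity
  simp only [linFactor]
  push_cast
  field_simp
  ring

theorem linFactor_ne_zero_real (u k n : ℕ) : (linFactor u k n : ℝ) ≠ 0 := by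
  exact_mod_cast linFactor_ne_zero u k n

theorem bmTransform_real (u v k : ℕ) (x : ℕ → ℚ) (n : ℕ) : (bmTransform u v k x n : ℝ) =
    (x (n + 1) + bmCoeff u v k (n + 1) * x n) / linFactor u k n := by
  simp [bmTransform]

/-- The numerator is of order `(2 - 1) n² q n` and the linear factor of order `2n`. -/
theorem IsFundamental.tendsto_bm_div {u v k : ℕ} {p q : ℕ → ℚ} (h : IsFundamental u v k p q) :
    Tendsto (fun n : ℕ => (bmTransform u v k q n : ℝ) / (n * q n)) atTop (𝓝 (1 / 2)) := by
  have l := (h.growth.add (tendsto_bmCoeff u v k)).div (tendsto_linFactor u k) two_ne_zero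
  rw [show ((2 : ℝ) + -1) / 2 = 1 / 2 by norm_num] at l
  refine l.congr' ?_
  filter_upwards [eventually_gt_atTop 0, h.eventually_ne] with n hn hq
  have hn' : (n : ℝ) ≠ 0 := by positivity
  have hl := linFactor_ne_zero_real u k n
  simp only [Pi.div_apply]
  rw [bmTransform_real]
  field_simp

theorem IsFundamental.bm {u v k : ℕ} {p q : ℕ → ℚ} (h : IsFundamental u v k p q) :
    IsFundamental u v (k + 1) (bmTransform u v k p) (bmTransform u v k q) := by
  have hb := h.tendsto_bm_div
  have hb1 := (tendsto_add_atTop_iff_nat 1).2 hb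
  have hne := hb.eventually_ne (by norm_num : (1 / 2 : ℝ) ≠ 0)
  have hne1 := hb1.eventually_ne (by norm_num : (1 / 2 : ℝ) ≠ 0)
  have hq := h.eventually_ne
  have hq1 : ∀ᶠ n in atTop, (q (n + 1) : ℝ) ≠ 0 := (tendsto_add_atTop_nat 1).eventually hq
  have hq' : ∀ᶠ n in atTop, (bmTransform u v k q n : ℝ) ≠ 0 := by
    filter_upwards [hne] with n hn h0
    simp [h0] at hn
  have hq1' : ∀ᶠ n in atTop, (bmTransform u v k q (n + 1) : ℝ) ≠ 0 :=
    (tendsto_add_atTop_nat 1).eventually hq'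
  have hc : (-8 * (k + 1) * (k + 1 + v) * (k + 1 + u + v) : ℝ) ≠ 0 := by
    have : (0 : ℝ) < 8 * (k + 1) * (k + 1 + v) * (k + 1 + u + v) := by positivity
    intro h0
    linarith
  have hinv := hb.inv₀ (by norm_num : (1 / 2 : ℝ) ≠ 0)
  have hinv1 := hb1.inv₀ (by norm_num : (1 / 2 : ℝ) ≠ 0)
  refine ⟨h.num.bmTransform, h.den.bmTransform, ?_, ?_, ?_, ?_⟩
  · intro h0
    have e := wronskian_bmTransform h.num h.den 0
    rw [h0, zero_mul] at e
    refine mul_ne_zero ?_ h.wronskian_ne e.symm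
    exact_mod_cast hc
  · have l := ((hb1.mul tendsto_succ_div_self).mul h.growth).mul hinv
    rw [show (1 / 2 : ℝ) * 1 * 2 * (1 / 2)⁻¹ = 2 by norm_num] at l
    refine l.congr' ?_
    filter_upwards [eventually_gt_atTop 0, hq, hq1, hq'] with n hn h0 h1 h2
    have hn' : (n : ℝ) ≠ 0 := by positivity
    push_cast
    field_simp
  · have l := ((h.growth.mul ((tendsto_add_atTop_iff_nat 1).2 h.tendsto)).add
      ((tendsto_bmCoeff u v k).mul h.tendsto)).div (h.growth.add (tendsto_bmCoeff u v k))
        (by norm_num)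
    rw [show (2 * Real.pi ^ 2 + -1 * Real.pi ^ 2) / (2 + -1) = Real.pi ^ 2 by ring] at l
    refine l.congr' ?_
    filter_upwards [eventually_gt_atTop 0, hq, hq1, hq'] with n hn h0 h1 h2
    have hn' : (n : ℝ) ≠ 0 := by positivity
    have hl := linFactor_ne_zero_real u k n
    have e : (bmTransform u v k q n : ℝ) * linFactor u k n =
        q (n + 1) + bmCoeff u v k (n + 1) * q n := by
      exact_mod_cast bmTransform_mul u v k q n
    have e0 : (q (n + 1) : ℝ) / ((n : ℝ) ^ 2 * q n) + bmCoeff u v k (n + 1) / (n : ℝ) ^ 2 =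
        bmTransform u v k q n * linFactor u k n / ((n : ℝ) ^ 2 * q n) := by
      rw [e]
      field_simp
    simp only [Pi.div_apply]
    rw [e0, bmTransform_real u v k p]
    field_simp
  · obtain ⟨κ, hκ, hr⟩ := h.rate
    -- The three extra powers of `n`: one from the linear factor dividing the Wronskian, two from
    -- the product of consecutive new denominators.
    have l := (((((tendsto_linFactor u k).inv₀ two_ne_zero).mul hinv).mul hinv1).mul
      (tendsto_succ_div_self.inv₀ one_ne_zero)).mul hr |>.const_mul
        (-8 * (k + 1) * (k + 1 + v) * (k + 1 + u + v) : ℝ)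
    refine ⟨_, ?_, l.congr' ?_⟩
    · exact mul_ne_zero hc (mul_ne_zero (by norm_num) hκ)
    filter_upwards [eventually_gt_atTop 0, hq, hq1, hq', hq1'] with n hn h0 h1 h2 h3
    have hn' : (0 : ℝ) < n := by positivity
    have hl := linFactor_ne_zero_real u k n
    have e : (wronskian (bmTransform u v k p) (bmTransform u v k q) n : ℝ) * linFactor u k n =
      -8 * (k + 1) * (k + 1 + v) * (k + 1 + u + v) * wronskian p q n := by
      exact_mod_cast wronskian_bmTransform h.num h.den n
    have e' := eq_div_of_mul_eq hl e
    have ep : (n : ℝ) ^ ((u : ℝ) + 2 * v + 3 / 2 + 3 * ((k + 1 : ℕ) : ℝ)) =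
        (n : ℝ) ^ ((u : ℝ) + 2 * v + 3 / 2 + 3 * k) * (n : ℝ) ^ 3 := by
      rw [← Real.rpow_natCast (n : ℝ) 3, ← Real.rpow_add hn']
      congr 1
      push_cast
      ring
    rw [e', ep]
    push_cast
    field_simp

theorem exists_isFundamental (u v k : ℕ) : ∃ p q, IsFundamental u v k p q := by
  induction k with
  | zero => exact exists_isFundamental_zero u v
  | succ k ih =>
    obtain ⟨p, q, h⟩ := ih
    exact ⟨_, _, h.bm⟩

/-! ### From solutions of the recurrence to continued fractions. -/

namespace RatCF

theorem wronskian_succ (F : RatCF) (n : ℕ) :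
    wronskian F.p F.q (n + 1) = -F.b (n + 1) * wronskian F.p F.q n := by
  simp only [wronskian, F.p_add_two, F.q_add_two]
  ring

theorem wronskian_ne_zero (F : RatCF) (n : ℕ) : wronskian F.p F.q n ≠ 0 := by
  induction n with
  | zero =>
    simp only [wronskian, zero_add, F.p_one, F.q_one, F.p_zero, F.q_zero]
    convert! F.b_ne_zero 0 using 1
    ring
  | succ n ih =>
    rw [F.wronskian_succ]
    exact mul_ne_zero (neg_ne_zero.2 (F.b_ne_zero _)) ih

/-- Division by `q 0` enforces the normalization `q₀ = 1`; then `a₀`, `a₁` and `b₀` are forced by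
the formulas for `p₀`, `q₁` and `p₁`. -/
theorem exists_of_recurrence_of_ne {a b p q : ℕ → ℚ} (hb : ∀ n, b (n + 1) ≠ 0)
    (hp : ∀ n, p (n + 2) = a (n + 2) * p (n + 1) + b (n + 1) * p n)
    (hq : ∀ n, q (n + 2) = a (n + 2) * q (n + 1) + b (n + 1) * q n)
    (hW : wronskian p q 0 ≠ 0) (h0 : q 0 ≠ 0) :
    ∃ F : RatCF, (∀ n, F.a (n + 2) = a (n + 2)) ∧ (∀ n, F.b (n + 1) = b (n + 1)) ∧
      ∀ n, F.p n = p n / q 0 ∧ F.q n = q n / q 0 := by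
  let F : RatCF :=
    { a := fun n => match n with
        | 0 => p 0 / q 0
        | 1 => q 1 / q 0
        | n + 2 => a (n + 2)
      b := fun n => match n with
        | 0 => wronskian p q 0 / q 0 ^ 2
        | n + 1 => b (n + 1)
      b_ne_zero := fun n => match n with
        | 0 => div_ne_zero hW (pow_ne_zero 2 h0)
        | n + 1 => hb n }
  refine ⟨F, fun _ => rfl, fun _ => rfl, fun n => ?_⟩
  induction n using Nat.twoStepInduction with
  | zero => exact ⟨rfl, by rw [F.q_zero, div_self h0]⟩
  | one =>
    refine ⟨?_, F.q_one⟩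
    rw [F.p_one]
    change q 1 / q 0 * (p 0 / q 0) + wronskian p q 0 / q 0 ^ 2 = _
    simp only [wronskian]
    field_simp
    ring
  | more n h1 h2 =>
    rw [F.p_add_two, F.q_add_two, h1.1, h1.2, h2.1, h2.2, hp, hq]
    change a (n + 2) * _ + b (n + 1) * _ = _ ∧ a (n + 2) * _ + b (n + 1) * _ = _
    constructor <;> ring

/-- Two linearly independent solutions of a three-term recurrence are, up to a common factor,
eventually the numerators and denominators of a continued fraction. -/
theorem exists_of_recurrence {a b p q : ℕ → ℚ} (hb : ∀ n, b (n + 1) ≠ 0)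
    (hp : ∀ n, p (n + 2) = a (n + 2) * p (n + 1) + b (n + 1) * p n)
    (hq : ∀ n, q (n + 2) = a (n + 2) * q (n + 1) + b (n + 1) * q n)
    (hW : wronskian p q 0 ≠ 0) :
    ∃ F : RatCF, ∃ c : ℚ, c ≠ 0 ∧ (∀ n, F.a (n + 3) = a (n + 3)) ∧
      (∀ n, F.b (n + 1) = b (n + 1)) ∧ ∀ n, F.p (n + 1) = p (n + 1) / c ∧
        F.q (n + 1) = q (n + 1) / c := by
  by_cases h0 : q 0 = 0
  · have h1 : q 1 ≠ 0 := by
      intro h1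
      simp [wronskian, h0, h1] at hW
    -- If `q 0 = 0`, replacing `x 0` by `x 0 + x 1` and `a 2` by `a 2 - b 1` keeps the later terms
    -- and the Wronskian at 0, and makes the initial denominator `q 1 ≠ 0`.
    have key : ∀ x : ℕ → ℚ, (∀ n, x (n + 2) = a (n + 2) * x (n + 1) + b (n + 1) * x n) →
        ∀ n, Function.update x 0 (x 0 + x 1) (n + 2) =
          Function.update a 2 (a 2 - b 1) (n + 2) * Function.update x 0 (x 0 + x 1) (n + 1) +
            b (n + 1) * Function.update x 0 (x 0 + x 1) n := by
      intro x hx n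
      rcases n with _ | n
      · have := hx 0
        simp only [zero_add] at this
        simp [this]
        ring
      · have := hx (n + 1)
        simpa using this
    obtain ⟨F, h2, h3, h4⟩ := exists_of_recurrence_of_ne hb (key p hp) (key q hq)
      (by simp only [wronskian] at hW ⊢; simp; intro h; apply hW; linarith) (by simpa [h0] using h1)
    refine ⟨F, q 0 + q 1, ?_, fun n => ?_, h3, fun n => ?_⟩
    · simpa [h0] using h1
    · simpa using h2 (n + 1)
    · simpa using h4 (n + 1)
  · obtain ⟨F, h2, h3, h4⟩ := exists_of_recurrence_of_ne hb hp hq hW h0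
    exact ⟨F, q 0, h0, fun n => h2 (n + 1), h3, fun n => h4 (n + 1)⟩

end RatCF

theorem represents_pi_sq (u v k : ℕ) : Represents (polyA u v) (polyB u v k) (Real.pi ^ 2) := by
  obtain ⟨p, q, h⟩ := exists_isFundamental u v k
  obtain ⟨F, c, hc, ha, hb, hF⟩ := RatCF.exists_of_recurrence
    (a := fun n => (polyA u v).eval (n : ℚ)) (b := fun n => (polyB u v k).eval (n : ℚ))
    (p := p) (q := q) (fun n => by push_cast; exact polyB_eval_succ_ne_zero u v k n)
    (fun n => by push_cast; exact h.num n) (fun n => by push_cast; exact h.den n) h.wronskian_ne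
  have hc' : (c : ℝ) ≠ 0 := by exact_mod_cast hc
  refine ⟨F, ⟨?_, ?_⟩, ?_⟩
  · filter_upwards [h.eventually_ne, eventually_ge_atTop 1] with n hn h1
    obtain ⟨m, rfl⟩ := Nat.exists_eq_add_of_le' h1
    rw [(hF m).2]
    exact div_ne_zero (by exact_mod_cast hn) hc
  · refine h.tendsto.congr' ?_
    filter_upwards [eventually_ge_atTop 1] with n h1
    obtain ⟨m, rfl⟩ := Nat.exists_eq_add_of_le' h1
    rw [(hF m).1, (hF m).2]
    push_cast
    rw [div_div_div_cancel_right₀ hc']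
  · filter_upwards [eventually_ge_atTop 3] with n h1
    obtain ⟨m, rfl⟩ := Nat.exists_eq_add_of_le' h1
    exact ⟨ha m, hb (m + 2)⟩

/-! ### The convergence rate of an arbitrary admissible continued fraction. -/

/-- Two sequences satisfying a three-term recurrence from `N` on, with nonzero Wronskian at `N`, span
its solutions. -/
theorem exists_eq_linear_combination {a b p q x : ℕ → ℚ} {N : ℕ}
    (hp : ∀ n ≥ N, p (n + 2) = a n * p (n + 1) + b n * p n)
    (hq : ∀ n ≥ N, q (n + 2) = a n * q (n + 1) + b n * q n)
    (hx : ∀ n ≥ N, x (n + 2) = a n * x (n + 1) + b n * x n) (hW : wronskian p q N ≠ 0) :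
    ∃ c d : ℚ, ∀ n ≥ N, x n = c * p n + d * q n := by
  have hW' := hW
  rw [wronskian] at hW'
  have hs : ∃ c d : ℚ, x N = c * p N + d * q N ∧ x (N + 1) = c * p (N + 1) + d * q (N + 1) := by
    refine ⟨(x (N + 1) * q N - x N * q (N + 1)) / (p (N + 1) * q N - p N * q (N + 1)),
      (x N * p (N + 1) - x (N + 1) * p N) / (p (N + 1) * q N - p N * q (N + 1)), ?_, ?_⟩
    · rw [div_mul_eq_mul_div, div_mul_eq_mul_div, ← add_div, eq_div_iff hW']
      ring
    · rw [div_mul_eq_mul_div, div_mul_eq_mul_div, ← add_div, eq_div_iff hW']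
      ring
  obtain ⟨c, d, h0, h1⟩ := hs
  refine ⟨c, d, fun n hn => ?_⟩
  obtain ⟨m, rfl⟩ := Nat.exists_eq_add_of_le hn
  clear hn
  induction m using Nat.twoStepInduction with
  | zero => exact h0
  | one => exact h1
  | more m e0 e1 =>
    have g : N + m ≥ N := Nat.le_add_right _ _
    rw [show N + (m + 2) = N + m + 2 from rfl, hp _ g, hq _ g, hx _ g,
      show N + m + 1 = N + (m + 1) from rfl, e0, e1]
    ring

/-- Stolz–Cesàro theorem for null sequences. -/
theorem tendsto_div_of_tendsto_sub_succ_div {e s : ℕ → ℝ} {L : ℝ} (he : Tendsto e atTop (𝓝 0))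
    (hs : Tendsto s atTop (𝓝 0)) (hs0 : ∀ᶠ n in atTop, s (n + 1) < s n)
    (h : Tendsto (fun n => (e n - e (n + 1)) / (s n - s (n + 1))) atTop (𝓝 L)) :
    Tendsto (fun n => e n / s n) atTop (𝓝 L) := by
  have mono : ∀ {f : ℕ → ℝ} {N : ℕ}, Tendsto f atTop (𝓝 0) → (∀ n ≥ N, f (n + 1) ≤ f n) →
      ∀ n ≥ N, 0 ≤ f n := by
    intro f N hf hN n hn
    refine le_of_tendsto hf ?_
    filter_upwards [eventually_ge_atTop n] with m hm
    induction m, hm using Nat.le_induction with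
    | base => exact le_rfl
    | succ m hm ih => exact (hN m (hn.trans hm)).trans ih
  rw [Metric.tendsto_atTop] at h ⊢
  intro ε hε
  obtain ⟨N₁, h₁⟩ := h (ε / 2) (by positivity)
  obtain ⟨N₂, h₂⟩ := eventually_atTop.1 hs0
  refine ⟨max N₁ N₂, fun n hn => ?_⟩
  have hb : ∀ m ≥ max N₁ N₂, |e m - e (m + 1) - L * (s m - s (m + 1))| ≤
      ε / 2 * (s m - s (m + 1)) := by
    intro m hm
    have d : 0 < s m - s (m + 1) := sub_pos.2 (h₂ m (le_of_max_le_right hm))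
    have := (h₁ m (le_of_max_le_left hm)).le
    rw [Real.dist_eq] at this
    rw [show e m - e (m + 1) - L * (s m - s (m + 1)) =
      ((e m - e (m + 1)) / (s m - s (m + 1)) - L) * (s m - s (m + 1)) by
        rw [sub_mul, div_mul_cancel₀ _ d.ne'], abs_mul, abs_of_pos d]
    exact mul_le_mul_of_nonneg_right this d.le
  have hL := hs.const_mul L
  have hE := hs.const_mul (ε / 2)
  rw [mul_zero] at hL hE
  -- By `hb`, both `ε/2 * s ± (e - L * s)` are eventually nonincreasing null sequences, hence
  -- nonnegative.
  have u1 := mono (f := fun n => ε / 2 * s n - (e n - L * s n)) (N := max N₁ N₂)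
    (by simpa using hE.sub (he.sub hL))
    (fun m hm => by have := (abs_le.1 (hb m hm)).2; linarith) n hn
  have u2 := mono (f := fun n => ε / 2 * s n + (e n - L * s n)) (N := max N₁ N₂)
    (by simpa using hE.add (he.sub hL))
    (fun m hm => by have := (abs_le.1 (hb m hm)).1; linarith) n hn
  have s1 := mono hs (fun m hm => (h₂ m (le_of_max_le_right hm)).le) (n + 1)
    (Nat.le_succ_of_le hn)
  have sp : 0 < s n := s1.trans_lt (h₂ n (le_of_max_le_right hn))
  rw [Real.dist_eq, show e n / s n - L = (e n - L * s n) / s n by field_simp, abs_div,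
    abs_of_pos sp, div_lt_iff₀ sp, abs_lt]
  constructor <;> nlinarith

/-- A null sequence whose differences are asymptotic to `κ 2⁻ⁿ n^{-σ}` is asymptotic to
`2κ 2⁻ⁿ n^{-σ}`. -/
theorem tendsto_mul_of_tendsto_sub_succ_mul {e : ℕ → ℝ} {κ σ : ℝ} (hσ : 0 ≤ σ)
    (he : Tendsto e atTop (𝓝 0))
    (h : Tendsto (fun n : ℕ => (e n - e (n + 1)) * 2 ^ n * (n : ℝ) ^ σ) atTop (𝓝 κ)) :
    Tendsto (fun n : ℕ => e n * 2 ^ n * (n : ℝ) ^ σ) atTop (𝓝 (2 * κ)) := by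
  set s : ℕ → ℝ := fun n => 1 / (2 ^ n * (n : ℝ) ^ σ) with hs
  have pos : ∀ n : ℕ, 0 < n → 0 < (n : ℝ) ^ σ := fun n hn => by positivity
  -- Each difference of the comparison sequence is about half of its current term, whence the factor
  -- 2.
  have hr : Tendsto (fun n : ℕ => (s n - s (n + 1)) * 2 ^ n * (n : ℝ) ^ σ) atTop (𝓝 (1 / 2)) := by
    have l := (((tendsto_succ_rpow_div σ).inv₀ one_ne_zero).const_mul (1 / 2)).const_sub 1
    rw [show (1 : ℝ) - 1 / 2 * 1⁻¹ = 1 / 2 by norm_num] at l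
    refine l.congr' ?_
    filter_upwards [eventually_gt_atTop 0] with n hn
    have p0 := pos n hn
    have p1 := pos (n + 1) n.succ_pos
    push_cast at p1
    simp only [hs, pow_succ]
    push_cast
    field_simp
  have hs0 : Tendsto s atTop (𝓝 0) := by
    refine squeeze_zero' (g := fun n => (1 / 2 : ℝ) ^ n) ?_ ?_
      (tendsto_pow_atTop_nhds_zero_of_lt_one (by norm_num) (by norm_num))
    · exact Eventually.of_forall fun n => by positivity
    · filter_upwards [eventually_ge_atTop 1] with n hn
      have : (1 : ℝ) ≤ (n : ℝ) ^ σ := Real.one_le_rpow (by exact_mod_cast hn) hσ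
      rw [one_div_pow]
      refine one_div_le_one_div_of_le (by positivity) ?_
      exact le_mul_of_one_le_right (by positivity) this
  have hlt : ∀ᶠ n in atTop, s (n + 1) < s n := by
    filter_upwards [hr.eventually_const_lt (by norm_num : (0 : ℝ) < 1 / 2),
      eventually_gt_atTop 0] with n h1 hn
    have p0 := pos n hn
    have := pos_of_mul_pos_left (pos_of_mul_pos_left h1 p0.le) (by positivity)
    linarith
  have := tendsto_div_of_tendsto_sub_succ_div (L := 2 * κ) he hs0 hlt ?_
  · refine this.congr fun n => ?_
    simp only [hs]
    rw [div_div_eq_mul_div, div_one, mul_assoc]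
  · have l := h.div hr (by norm_num)
    rw [show κ / (1 / 2) = 2 * κ by ring] at l
    refine l.congr' ?_
    filter_upwards [eventually_gt_atTop 0] with n hn
    have p0 := pos n hn
    simp only [Pi.div_apply]
    rw [mul_div_mul_right _ _ p0.ne', mul_div_mul_right _ _ (by positivity)]

/-- The difference of consecutive convergents is the Wronskian over the product of denominators.
Passing to the fundamental pair multiplies the Wronskian by a nonzero determinant and the
denominators, asymptotically, by the constant `c₂ π² + d₂`. -/
theorem RatCF.exists_tendsto_rate {u v k : ℕ} {F : RatCF}
    (hF : F.EventuallyGivenBy (polyA u v) (polyB u v k)) (hc : F.ConvergesTo (Real.pi ^ 2)) :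
    ∃ κ : ℝ, κ ≠ 0 ∧ Tendsto (fun n : ℕ => ((F.p (n + 1) : ℝ) / F.q (n + 1) - F.p n / F.q n) *
      2 ^ n * (n : ℝ) ^ ((u : ℝ) + 2 * v + 3 / 2 + 3 * k)) atTop (𝓝 κ) := by
  obtain ⟨p, q, h⟩ := exists_isFundamental u v k
  obtain ⟨κ, hκ, hr⟩ := h.rate
  obtain ⟨N, hN⟩ := eventually_atTop.1 hF
  have hW := h.num.wronskian_ne_zero h.den h.wronskian_ne N
  have hFa : ∀ n ≥ N, F.a (n + 2) = (polyA u v).eval ((n : ℚ) + 2) := fun n hn => by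
    have := (hN (n + 2) (by omega)).1
    push_cast at this
    exact this
  have hFb : ∀ n ≥ N, F.b (n + 1) = (polyB u v k).eval ((n : ℚ) + 1) := fun n hn => by
    have := (hN (n + 1) (by omega)).2
    push_cast at this
    exact this
  obtain ⟨c₁, d₁, h₁⟩ := exists_eq_linear_combination (N := N) (fun n _ => h.num n)
    (fun n _ => h.den n) (x := F.p) (fun n hn => by rw [F.p_add_two, hFa n hn, hFb n hn]) hW
  obtain ⟨c₂, d₂, h₂⟩ := exists_eq_linear_combination (N := N) (fun n _ => h.num n)
    (fun n _ => h.den n) (x := F.q) (fun n hn => by rw [F.q_add_two, hFa n hn, hFb n hn]) hW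
  have hWF : ∀ n ≥ N, wronskian F.p F.q n = (c₁ * d₂ - d₁ * c₂) * wronskian p q n := by
    intro n hn
    simp only [wronskian]
    rw [h₁ n hn, h₁ (n + 1) (by omega), h₂ n hn, h₂ (n + 1) (by omega)]
    ring
  have hdet : (c₁ * d₂ - d₁ * c₂ : ℝ) ≠ 0 := by
    intro h0
    have h0' : c₁ * d₂ - d₁ * c₂ = 0 := by exact_mod_cast h0
    apply F.wronskian_ne_zero N
    rw [hWF N le_rfl, h0', zero_mul]
  have lim : ∀ (x : ℕ → ℚ) (c d : ℚ), (∀ n ≥ N, x n = c * p n + d * q n) →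
      Tendsto (fun n => (x n : ℝ) / q n) atTop (𝓝 (c * Real.pi ^ 2 + d)) := by
    intro x c d hx
    refine ((h.tendsto.const_mul (c : ℝ)).add_const (d : ℝ)).congr' ?_
    filter_upwards [eventually_ge_atTop N, h.eventually_ne] with n hn hq
    rw [hx n hn]
    push_cast
    field_simp
  have l₁ := lim _ _ _ h₁
  have l₂ := lim _ _ _ h₂
  have hFq : ∀ᶠ n in atTop, (F.q n : ℝ) ≠ 0 := by
    filter_upwards [hc.1] with n hn
    exact_mod_cast hn
  -- If this vanished, convergence to `π²` would force `c₁ π² + d₁ = 0` as well, and the determinant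
  -- would be zero.
  have hne : c₂ * Real.pi ^ 2 + d₂ ≠ 0 := by
    intro h0
    rw [h0] at l₂
    have l := hc.2.mul l₂
    rw [mul_zero] at l
    have h0' : c₁ * Real.pi ^ 2 + d₁ = 0 := by
      refine tendsto_nhds_unique l₁ (l.congr' ?_)
      filter_upwards [hFq] with n hn
      field_simp
    apply hdet
    linear_combination (c₁ : ℝ) * h0 - c₂ * h0'
  have i₂ := l₂.inv₀ hne
  have i₂' := (tendsto_add_atTop_iff_nat 1).2 i₂
  refine ⟨_, ?_, ((hr.mul (i₂.mul i₂')).const_mul (c₁ * d₂ - d₁ * c₂ : ℝ)).congr' ?_⟩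
  · exact mul_ne_zero hdet (mul_ne_zero hκ (mul_ne_zero (inv_ne_zero hne) (inv_ne_zero hne)))
  · have s1 := tendsto_add_atTop_nat 1
    filter_upwards [eventually_ge_atTop N, h.eventually_ne, s1.eventually h.eventually_ne, hFq,
      s1.eventually hFq] with n hn q0 q1 f0 f1
    have w : (F.p (n + 1) : ℝ) * F.q n - F.p n * F.q (n + 1) =
        (c₁ * d₂ - d₁ * c₂) * wronskian p q n := by
      have := hWF n hn
      rw [wronskian] at this
      exact_mod_cast this
    rw [div_sub_div _ _ f1 f0, mul_comm (F.q (n + 1) : ℝ) (F.p n : ℝ), w]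
    field_simp

theorem mainTheorem7 (u v k : ℕ) :
    Represents (polyA u v) (polyB u v k) (Real.pi ^ 2) ∧
    ∀ F : RatCF, F.EventuallyGivenBy (polyA u v) (polyB u v k) →
      F.ConvergesTo (Real.pi ^ 2) →
      ∃ C : ℝ, C ≠ 0 ∧
        (fun n : ℕ => Real.pi ^ 2 - (F.p n : ℝ) / (F.q n : ℝ)) ~[atTop]
          (fun n : ℕ => C / ((2 : ℝ) ^ n *
            (n : ℝ) ^ ((u : ℝ) + 2 * (v : ℝ) + 3 / 2 + 3 * (k : ℝ)))) := by
  refine ⟨represents_pi_sq u v k, fun F hF hc => ?_⟩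
  obtain ⟨κ, hκ, h⟩ := RatCF.exists_tendsto_rate hF hc
  refine ⟨2 * κ, mul_ne_zero two_ne_zero hκ, ?_⟩
  have he : Tendsto (fun n : ℕ => Real.pi ^ 2 - (F.p n : ℝ) / (F.q n : ℝ)) atTop (𝓝 0) := by
    have := hc.2.const_sub (Real.pi ^ 2)
    rwa [sub_self] at this
  have l := tendsto_mul_of_tendsto_sub_succ_mul
    (σ := (u : ℝ) + 2 * (v : ℝ) + 3 / 2 + 3 * (k : ℝ)) (by positivity) he
    (h.congr fun n => by ring)
  have hpos : ∀ n : ℕ, 0 < n →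
      0 < (2 : ℝ) ^ n * (n : ℝ) ^ ((u : ℝ) + 2 * (v : ℝ) + 3 / 2 + 3 * (k : ℝ)) :=
    fun n hn => by positivity
  rw [isEquivalent_iff_tendsto_one]
  · have l' := l.div_const (2 * κ)
    rw [div_self (mul_ne_zero two_ne_zero hκ)] at l'
    refine l'.congr' ?_
    filter_upwards [eventually_gt_atTop 0] with n hn
    have := hpos n hn
    simp only [Pi.div_apply]
    rw [div_div_eq_mul_div, mul_assoc]
  · filter_upwards [eventually_gt_atTop 0] with n hn
    exact div_ne_zero (mul_ne_zero two_ne_zero hκ) (hpos n hn).ne'
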